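/- All graphs are finite, simple and undirected. For a connected graph $G$ with at least one edge, with distance $d$, an independent broadcast on $G$ is a function $f:V(G)\to\{0,\dots,\operatorname{diam}(G)\}$ such that $f(v)\le e(v)$ for every vertex $v$, where $e(v)$ is the eccentricity of $v$, and $d(u,v)>\max\{f(u),f(v)\}$ for every two distinct vertices $u,v$ with $f(u)>0$ and $f(v)>0$. The broadcast independence number $\beta_b(G)$ is the maximum of $\sum_{v} f(v)$ over all independent broadcasts $f$ on $G$, and the independence number $\alpha(G)$ is the maximum cardinality of a set of pairwise non-adjacent vertices of $G$. For integers $n\ge 3$ and $1\le a\le\lfloor n/2\rfloor$, the circulant graph $C(n;1,a)$ has vertices $v_0,\dots,v_{n-1}$ and edges $v_iv_{i+1}$ and $v_iv_{i+a}$ for $0\le i\le n-1$, with subscripts taken modulo $n$. **Theorem.** Let $a$ and $q$ be integers with $a\ge 5$ and $q\ge 4$. Then $$\beta_b(C(qa;1,a))=\alpha(C(qa;1,a))=\begin{cases} \dfrac{qa}{2}, & \text{if } a \text{ is odd and } q \text{ is even},\\[2ex] \dfrac{(q-1)a}{2}, & \text{if } a \text{ and } q \text{ are odd},\\[2ex]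 \left\lfloor\dfrac{qa^2}{2(a+1)}\right\rfloor, & \text{if } a \text{ and } q \text{ are even},\\[2ex] \min\left\{\left\lfloor\dfrac{qa^2}{2(a+1)}\right\rfloor,\ \dfrac{(q-1)a}{2}\right\}, & \text{if } a \text{ is even and } q \text{ is odd}. \end{cases}$$ -/

import Mathlib

/-- A broadcast on a (nontrivial connected) graph `G`: a function `f : V → {0, …, diam G}` such
that `f v` is at most the eccentricity of `v`, for every vertex `v`. -/
structure IsBroadcast {V : Type*} (G : SimpleGraph V) (f : V → ℕ) : Prop where
  le_diam : ∀ v, f v ≤ G.diam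
  le_eccent : ∀ v, (f v : ℕ∞) ≤ G.eccent v

/-- The broadcast vertices of `f`: those with a positive value. -/
def broadcastVertices {V : Type*} [Fintype V] (f : V → ℕ) : Finset V :=
  {v | 0 < f v}

/-- The cost of `f`: the sum of the values over all broadcast vertices. -/
def broadcastCost {V : Type*} [Fintype V] (f : V → ℕ) : ℕ :=
  ∑ v ∈ broadcastVertices f, f v

/-- A broadcast is independent if any two distinct broadcast vertices `u`, `v` satisfy
`d(u, v) > max {f u, f v}`. -/
structure IsIndepBroadcast {V : Type*} [Fintype V] (G : SimpleGraph V) (f : V → ℕ) : Prop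
    extends IsBroadcast G f where
  indep : ∀ u ∈ broadcastVertices f, ∀ v ∈ broadcastVertices f, u ≠ v →
    max (f u) (f v) < G.dist u v

/-- The broadcast independence number: the maximum cost of an independent broadcast on `G`. -/
noncomputable def broadcastIndepNum {V : Type*} [Fintype V] (G : SimpleGraph V) : ℕ :=
  sSup {c | ∃ f : V → ℕ, IsIndepBroadcast G f ∧ broadcastCost f = c}

/-- The supremum in the definition of `broadcastIndepNum` is attained: it is a maximum. -/
theorem isGreatest_broadcastIndepNum {V : Type*} [Fintype V] (G : SimpleGraph V) :
    IsGreatest {c | ∃ f : V → ℕ, IsIndepBroadcast G f ∧ broadcastCost f = c}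
      (broadcastIndepNum G) := by
  have hne : {c | ∃ f : V → ℕ, IsIndepBroadcast G f ∧ broadcastCost f = c}.Nonempty :=
    ⟨0, fun _ => 0, ⟨⟨fun _ => Nat.zero_le _, fun _ => by simp⟩,
      fun u hu => by simp [broadcastVertices] at hu⟩, by simp [broadcastCost]⟩
  have hbdd : BddAbove {c | ∃ f : V → ℕ, IsIndepBroadcast G f ∧ broadcastCost f = c} := by
    refine ⟨Fintype.card V * G.diam, ?_⟩
    rintro c ⟨f, hf, rfl⟩
    calc broadcastCost f ≤ ∑ v, f v :=
          Finset.sum_le_sum_of_subset (Finset.subset_univ _)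
      _ ≤ ∑ _v : V, G.diam := Finset.sum_le_sum fun v _ => hf.le_diam v
      _ = Fintype.card V * G.diam := by simp
  exact ⟨Nat.sSup_mem hne hbdd, fun c hc => le_csSup hbdd hc⟩

/-- The circulant graph `C(n; 1, a)`: the vertices are the residues modulo `n`, and the edges join
`i` to `i + 1` and `i` to `i + a`. -/
def circulantOneA (n a : ℕ) : SimpleGraph (ZMod n) :=
  SimpleGraph.circulantGraph {1, (a : ZMod n)}

/-! Write `n = q * a` and let `α` be the independence number. The equality of the two invariants
follows from `2 * n ≤ 5 * α` by trading an independent broadcast `f` for an independent set of at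
least the same size (`broadcastCost_le_indepNum`). A vertex `u` with `f u = m ≠ 2` is traded for `m`
independent vertices at distance at most `(m - 1) / 2` from `u` (`exists_indepSet_near`); the
separation condition keeps the sets of different `u` disjoint and non-adjacent. For `m = 2` that
ball is a single point, so the vertices of value 2 are handled together: their closed neighbourhoods
are disjoint with five elements each, and by averaging some translate of a maximum independent set
contains at least 2/5 of their union, two vertices per neighbourhood.

The value of `α` comes from two averaging principles. Translates of a closed walk give upper bounds
(`mul_indepNum_le`), used for the walk of `q` steps `a` and, when `a` is even, for the odd walk of
`a` steps `1` closed by one step `-a`. Pulling back an arc of a cyclic group gives lower bounds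
(`mul_le_indepNum_mul`): the group is `ZMod q` when the first upper bound is sharp, and `ZMod n`
itself, under multiplication by a constant, when the second is. -/

open Finset in
/-- Averaging over translates: some translate of `A` is hit by at least the expected number of
elements of `S`. -/
theorem exists_translate_card {H W : Type*} [AddCommGroup H] [Fintype H] [DecidableEq H]
    (φ : W → H) (A : Finset H) (S : Finset W) :
    ∃ s : H, #S * #A ≤ Fintype.card H * #{w ∈ S | φ w + s ∈ A} := by
  by_contra! h
  have hsum : ∑ s : H, #{w ∈ S | φ w + s ∈ A} = #S * #A := by
    simp_rw [card_filter]
    rw [sum_comm]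
    simp_rw [← card_filter]
    rw [sum_const_nat (m := #A)]
    intro w _
    refine card_bij (fun s _ => φ w + s) (by simp) (fun _ _ _ _ h => by simpa using h) ?_
    intro b hb
    exact ⟨b - φ w, by simpa using hb, by abel⟩
  have hlt : ∑ s : H, Fintype.card H * #{w ∈ S | φ w + s ∈ A} < ∑ _s : H, #S * #A :=
    sum_lt_sum_of_nonempty univ_nonempty fun s _ => h s
  rw [← mul_sum, hsum] at hlt
  simp at hlt

/-! ### Averaging bounds for the independence number of circulant graphs -/

namespace circulantOneA

variable {n a : ℕ}

theorem adj_iff {u v : ZMod n} : (circulantOneA n a).Adj u v ↔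
    u ≠ v ∧ (v = u + 1 ∨ v = u + a ∨ u = v + 1 ∨ u = v + a) := by
  simp only [circulantOneA, SimpleGraph.circulantGraph_adj, Set.mem_insert_iff,
    Set.mem_singleton_iff, sub_eq_iff_eq_add']
  tauto

theorem isIndepSet_of_forall {s : Set (ZMod n)}
    (h : ∀ i ∈ s, i + 1 ∉ s ∧ i + (a : ZMod n) ∉ s) : (circulantOneA n a).IsIndepSet s := by
  intro u hu v hv _ hadj
  rcases (adj_iff.1 hadj).2 with rfl | rfl | rfl | rfl
  exacts [(h _ hu).1 hv, (h _ hu).2 hv, (h _ hv).1 hu, (h _ hv).2 hu]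

theorem isIndepSet_translate {s : Set (ZMod n)} (h : (circulantOneA n a).IsIndepSet s)
    (t : ZMod n) : (circulantOneA n a).IsIndepSet {i | i + t ∈ s} := by
  intro u hu v hv huv hadj
  refine h hu hv (by simpa using huv) ?_
  rw [adj_iff] at hadj ⊢
  refine ⟨by simpa using huv, ?_⟩
  rcases hadj.2 with rfl | rfl | rfl | rfl
  · left; abel
  · right; left; abel
  · right; right; left; abel
  · right; right; right; abel

open Finset in
/-- A map to a cyclic group along which every edge moves by at least `L` in the cyclic distance
gives a large independent set. -/
theorem mul_le_indepNum_mul [NeZero n] {N L : ℕ} [NeZero N] (φ : ZMod n → ZMod N)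
    (h1 : ∀ i, L ≤ (φ (i + 1) - φ i).val ∧ (φ (i + 1) - φ i).val + L ≤ N)
    (ha : ∀ i, L ≤ (φ (i + a) - φ i).val ∧ (φ (i + a) - φ i).val + L ≤ N) :
    n * L ≤ N * (circulantOneA n a).indepNum := by
  set A : Finset (ZMod N) := {x | x.val < L} with hA
  have hLN : L ≤ N := by have := h1 0; omega
  have hAc : #A = L := by
    have : A = (range L).image (Nat.cast : ℕ → ZMod N) := by
      ext x
      simp only [hA, mem_filter, mem_univ, true_and, mem_image, mem_range]
      constructor
      · exact fun h => ⟨x.val, h, ZMod.natCast_zmod_val x⟩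
      · rintro ⟨m, hm, rfl⟩
        rwa [ZMod.val_natCast_of_lt (by omega)]
    rw [this, card_image_of_injOn, card_range]
    intro x hx y hy hxy
    simp only [coe_range, Set.mem_Iio] at hx hy
    have := congrArg ZMod.val hxy
    rwa [ZMod.val_natCast_of_lt (by omega), ZMod.val_natCast_of_lt (by omega)] at this
  -- A shift of the arc `[0, L)` by `d` in `[L, N - L]` leaves the arc without wrapping around.
  have key : ∀ x d : ZMod N, L ≤ d.val → d.val + L ≤ N → x ∈ A → x + d ∉ A := by
    intro x d h h' hx hxd
    simp only [hA, mem_filter, mem_univ, true_and, ZMod.val_add] at hx hxd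
    rw [Nat.mod_eq_of_lt (by omega)] at hxd
    omega
  obtain ⟨s, hs⟩ := exists_translate_card φ A univ
  rw [hAc, card_univ, ZMod.card, ZMod.card] at hs
  refine hs.trans (Nat.mul_le_mul_left _ (SimpleGraph.IsIndepSet.card_le_indepNum ?_))
  apply isIndepSet_of_forall
  intro i hi
  simp only [coe_filter, mem_univ, true_and, Set.mem_ofPred_eq] at hi ⊢
  constructor
  · have := key _ _ (h1 i).1 (h1 i).2 hi
    rwa [show φ i + s + (φ (i + 1) - φ i) = φ (i + 1) + s by abel] at this
  · have := key _ _ (ha i).1 (ha i).2 hi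
    rwa [show φ i + s + (φ (i + a) - φ i) = φ (i + a) + s by abel] at this

open Finset in
/-- Translates of a closed walk of length `L` bound the independence ratio by that of a cycle. -/
theorem mul_indepNum_le [NeZero n] {L : ℕ} [NeZero L] (w : ZMod L → ZMod n)
    (hw : ∀ j v, (circulantOneA n a).Adj (w j + v) (w (j + 1) + v)) :
    L * (circulantOneA n a).indepNum ≤ n * (L / 2) := by
  obtain ⟨I, hI⟩ := (circulantOneA n a).exists_isNIndepSet_indepNum
  obtain ⟨v, hv⟩ := exists_translate_card w I univ
  rw [hI.card_eq, card_univ, ZMod.card, ZMod.card] at hv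
  refine hv.trans (Nat.mul_le_mul_left _ ?_)
  set J : Finset (ZMod L) := {j | w j + v ∈ I}
  -- Consecutive walk positions are adjacent, so `J` and `J + 1` are disjoint in `ZMod L`, whence
  -- `#J ≤ L / 2`.
  have hdisj : Disjoint J (J.map (addRightEmbedding 1)) := by
    rw [disjoint_left]
    intro x hx hx'
    simp only [mem_map, addRightEmbedding_apply] at hx'
    obtain ⟨j, hj, rfl⟩ := hx'
    simp only [J, mem_filter, mem_univ, true_and] at hj hx
    exact hI.isIndepSet hj hx (hw j v).ne (hw j v)
  have := card_le_univ (disjUnion _ _ hdisj)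
  rw [card_disjUnion, card_map, ZMod.card] at this
  omega

end circulantOneA

/-! ### Upper and lower bounds for `C(qa; 1, a)` -/

namespace circulantOneA

theorem val_add_one_cases {L : ℕ} [NeZero L] (hL : 1 < L) (j : ZMod L) :
    (j + 1).val = j.val + 1 ∨ (j + 1).val = 0 ∧ j.val + 1 = L := by
  have hj := j.val_lt
  rw [ZMod.val_add, ZMod.val_one_eq_one_mod, Nat.mod_eq_of_lt hL]
  rcases Nat.lt_or_ge (j.val + 1) L with h | h
  · left; exact Nat.mod_eq_of_lt h
  · right
    have : j.val + 1 = L := by omega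
    simp [this]

variable {q a : ℕ}

theorem lt_mul_of_two_le (hq : 2 ≤ q) (ha : 1 ≤ a) : a < q * a := by nlinarith

theorem natCast_ne_zero_of_lt {n m : ℕ} (h0 : 0 < m) (h : m < n) : (m : ZMod n) ≠ 0 := by
  rw [Ne, ZMod.natCast_eq_zero_iff]
  exact fun hd => absurd (Nat.le_of_dvd h0 hd) (by omega)

theorem indepNum_le_column [NeZero (q * a)] (ha : 1 ≤ a) (hq : 2 ≤ q) :
    (circulantOneA (q * a) a).indepNum ≤ a * (q / 2) := by
  have : NeZero q := ⟨by omega⟩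
  have hlt := lt_mul_of_two_le hq ha
  have hne := natCast_ne_zero_of_lt (n := q * a) ha hlt
  have key : ∀ j : ZMod q, (((j + 1).val * a : ℕ) : ZMod (q * a)) =
      ((j.val * a : ℕ) : ZMod (q * a)) + a := by
    intro j
    rcases val_add_one_cases (by omega) j with h | ⟨h, h'⟩
    · rw [h]; push_cast; ring
    · have : ((j.val * a : ℕ) : ZMod (q * a)) + a = (((j.val + 1) * a : ℕ) : ZMod (q * a)) := by
        push_cast; ring
      rw [this, h, h', ZMod.natCast_self]; simp
  have := mul_indepNum_le (n := q * a) (a := a) (L := q)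
    (fun j => ((j.val * a : ℕ) : ZMod (q * a))) (by
      intro j v
      rw [adj_iff, key]
      refine ⟨?_, .inr (.inl (by abel))⟩
      intro h
      apply hne
      linear_combination -h)
  exact Nat.le_of_mul_le_mul_left (by rwa [mul_assoc] at this) (show 0 < q by omega)

theorem indepNum_le_window [NeZero (q * a)] (ha : 2 ≤ a) (hq : 2 ≤ q) (hae : Even a) :
    (a + 1) * (2 * (circulantOneA (q * a) a).indepNum) ≤ q * a * a := by
  have hlt := lt_mul_of_two_le hq (by omega : 1 ≤ a)
  have hne := natCast_ne_zero_of_lt (n := q * a) (by omega) hlt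
  have hne1 := natCast_ne_zero_of_lt (n := q * a) (m := 1) (by omega) (by omega)
  have := mul_indepNum_le (n := q * a) (a := a) (L := a + 1)
    (fun j => (j.val : ZMod (q * a))) (by
      intro j v
      rw [adj_iff]
      rcases val_add_one_cases (by omega) j with h | ⟨h, h'⟩
      · rw [h]
        refine ⟨?_, .inl (by push_cast; ring)⟩
        intro h
        apply hne1
        push_cast at h ⊢
        linear_combination -h
      · have h'' : j.val = a := by omega
        rw [h, h'']
        refine ⟨?_, .inr (.inr (.inr (by push_cast; ring)))⟩
        intro h
        apply hne
        push_cast at h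
        linear_combination h)
  obtain ⟨b, rfl⟩ := hae
  rw [show (b + b + 1) / 2 = b by omega] at this
  linarith

/-- A closed walk of `a` steps in the `q`-cycle with total displacement `1` gives a homomorphism of
the circulant graph to that cycle. -/
theorem le_indepNum_of_walk [NeZero (q * a)] (ha : 1 ≤ a) (hq : 2 ≤ q) (h : ℕ → ZMod q)
    (hstep : ∀ c, c + 1 < a → h (c + 1) = h c + 1 ∨ h (c + 1) = h c - 1)
    (hwrap : h 0 + 1 = h (a - 1) + 1 ∨ h 0 + 1 = h (a - 1) - 1) :
    a * (q / 2) ≤ (circulantOneA (q * a) a).indepNum := by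
  have : NeZero q := ⟨by omega⟩
  -- Row index plus a correction depending on the column; a step `a` adds 1, and a step `1` follows
  -- the walk `h`.
  set H : ℕ → ZMod q := fun m => (m / a : ℕ) + h (m % a) with hH
  have hmod : ∀ m, H (m % (q * a)) = H m := by
    intro m
    simp only [hH]
    rw [Nat.mod_mul_left_mod, Nat.mod_mul_left_div_self, ZMod.natCast_mod]
  have hcast : ∀ (i : ZMod (q * a)) (m : ℕ), H (i + m).val = H (i.val + m) := by
    intro i m
    rw [ZMod.val_add, hmod, ZMod.val_natCast]
    conv_lhs => rw [← hmod, Nat.add_mod_mod, hmod]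
  have hHa : ∀ m, H (m + a) = H m + 1 := by
    intro m
    simp only [hH]
    rw [Nat.add_div_right _ ha, Nat.add_mod_right]
    push_cast; ring
  have hH1 : ∀ m, H (m + 1) = H m + 1 ∨ H (m + 1) = H m - 1 := by
    intro m
    have hm := Nat.mod_lt m ha
    have hdm := Nat.div_add_mod m a
    simp only [hH]
    rcases Nat.lt_or_ge (m % a + 1) a with hc | hc
    · have e1 : (m + 1) / a = m / a := by
        rw [Nat.div_eq_iff ha]
        have := Nat.mul_comm a (m / a)
        omega
      have e2 : (m + 1) % a = m % a + 1 := by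
        rw [Nat.add_mod, Nat.mod_eq_of_lt (by omega : 1 < a), Nat.mod_eq_of_lt hc]
      rw [e1, e2]
      rcases hstep _ hc with h' | h' <;> rw [h']
      · left; ring
      · right; ring
    · have hc' : m % a = a - 1 := by omega
      have e : m + 1 = a * (m / a + 1) := by rw [Nat.mul_add]; omega
      rw [e, Nat.mul_div_cancel_left _ ha, Nat.mul_mod_right, hc']
      push_cast
      rcases hwrap with h' | h'
      · left; linear_combination h'
      · right; linear_combination h'
  -- Multiplication by `q / 2` stretches each edge of the `q`-cycle to the largest possible cyclic
  -- distance.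
  have hfar : ∀ x y : ZMod q, (x = y + 1 ∨ x = y - 1) →
      q / 2 ≤ (((q / 2 : ℕ) : ZMod q) * x - ((q / 2 : ℕ) : ZMod q) * y).val ∧
      (((q / 2 : ℕ) : ZMod q) * x - ((q / 2 : ℕ) : ZMod q) * y).val + q / 2 ≤ q := by
    rintro x y (rfl | rfl)
    · rw [show ((q / 2 : ℕ) : ZMod q) * (y + 1) - ((q / 2 : ℕ) : ZMod q) * y
        = ((q / 2 : ℕ) : ZMod q) by ring, ZMod.val_natCast_of_lt (by omega)]
      omega
    · rw [show ((q / 2 : ℕ) : ZMod q) * (y - 1) - ((q / 2 : ℕ) : ZMod q) * y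
        = ((q - q / 2 : ℕ) : ZMod q) by
          rw [Nat.cast_sub (by omega), ZMod.natCast_self]; ring, ZMod.val_natCast_of_lt (by omega)]
      omega
  have := mul_le_indepNum_mul (n := q * a) (a := a) (N := q) (L := q / 2)
    (fun i => ((q / 2 : ℕ) : ZMod q) * H i.val)
    (fun i => hfar _ _ (by
      have := hcast i 1
      rw [Nat.cast_one] at this
      rw [this]; exact hH1 _))
    (fun i => hfar _ _ (by rw [hcast, hHa]; exact .inl rfl))
  rw [mul_assoc] at this
  exact Nat.le_of_mul_le_mul_left this (by omega)

theorem le_indepNum_of_odd [NeZero (q * a)] (hq : 2 ≤ q) (hao : Odd a) :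
    a * (q / 2) ≤ (circulantOneA (q * a) a).indepNum := by
  obtain ⟨b, rfl⟩ := hao
  refine le_indepNum_of_walk (by omega) hq (fun c => ((c % 2 : ℕ) : ZMod q)) ?_ (.inl ?_)
  · intro c _
    rcases Nat.mod_two_eq_zero_or_one c with h | h
    · left; rw [Nat.add_mod, h]; simp
    · right; rw [Nat.add_mod, h]; simp
  · simp

/-- For even `a` the walk must have odd length `a - 1` before its last step, so it winds once around
the odd `q`-cycle and spends the remaining steps going back and forth. Winding needs `q ≤ a - 1`. -/
theorem le_indepNum_of_even_of_lt [NeZero (q * a)] (hq : 2 ≤ q) (hae : Even a) (hqo : Odd q)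
    (hlt : q < a) : a * (q / 2) ≤ (circulantOneA (q * a) a).indepNum := by
  refine le_indepNum_of_walk (by omega) hq
    (fun c => -((min c (q - 1) + (c - (q - 1)) % 2 : ℕ) : ZMod q)) ?_ (.inl ?_)
  · intro c _
    rcases Nat.lt_or_ge c (q - 1) with h | h
    · right
      rw [show min (c + 1) (q - 1) + (c + 1 - (q - 1)) % 2 =
        min c (q - 1) + (c - (q - 1)) % 2 + 1 by omega]
      push_cast; ring
    · rcases Nat.mod_two_eq_zero_or_one (c - (q - 1)) with h' | h'
      · right
        rw [show min (c + 1) (q - 1) + (c + 1 - (q - 1)) % 2 =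
          min c (q - 1) + (c - (q - 1)) % 2 + 1 by omega]
        push_cast; ring
      · left
        rw [show min c (q - 1) + (c - (q - 1)) % 2 =
          min (c + 1) (q - 1) + (c + 1 - (q - 1)) % 2 + 1 by omega]
        push_cast; ring
  · obtain ⟨b, rfl⟩ := hae
    obtain ⟨p, rfl⟩ := hqo
    rw [show min (b + b - 1) (2 * p + 1 - 1) + (b + b - 1 - (2 * p + 1 - 1)) % 2 = 2 * p + 1 by
      omega, ZMod.natCast_self]
    simp

/-- Multiply by `p` in `ZMod (q * a)`. A step `1` moves by `p`; since `2 * p = -t` there, a step `a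
= 2 * b` moves by `-b * t`. The two inequalities on `t` say that this displacement has cyclic length
at least `p`. -/
theorem le_indepNum_of_even [NeZero (q * a)] (ha : 2 ≤ a) (hae : Even a) {p t : ℕ} (hp : 0 < p)
    (hpt : 2 * p + t = q * a) (h1 : q * a ≤ t * (a + 1)) (h2 : t * a ≤ q * a + t) :
    p ≤ (circulantOneA (q * a) a).indepNum := by
  obtain ⟨b, rfl⟩ := hae
  set n := q * (b + b)
  have hb : p ≤ b * t := by nlinarith
  have hb' : b * t + p ≤ n := by nlinarith
  have := mul_le_indepNum_mul (n := n) (a := b + b) (N := n) (L := p)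
    (fun i => i * (p : ZMod n))
    (by
      intro i
      rw [show (i + 1) * (p : ZMod n) - i * p = p by ring, ZMod.val_natCast_of_lt (by omega)]
      omega)
    (by
      intro i
      have hz : (2 : ZMod n) * p + t = 0 := by
        have := congrArg (Nat.cast : ℕ → ZMod n) hpt
        rw [ZMod.natCast_self] at this
        exact_mod_cast this
      rw [show (i + ((b + b : ℕ) : ZMod n)) * (p : ZMod n) - i * p = ((n - b * t : ℕ) : ZMod n) by
        rw [Nat.cast_sub (by omega), ZMod.natCast_self]
        push_cast
        linear_combination b * hz, ZMod.val_natCast_of_lt (by omega)]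
      omega)
  exact Nat.le_of_mul_le_mul_left this (by omega)

/-! ### Distance bounds -/

theorem edist_add_zsmul_le {n : ℕ} (s : ZMod n)
    (hs : ∀ u, (circulantOneA n a).edist u (u + s) ≤ 1) (u : ZMod n) (x : ℤ) :
    (circulantOneA n a).edist u (u + x * s) ≤ x.natAbs := by
  have hnat : ∀ (m : ℕ) (u : ZMod n), (circulantOneA n a).edist u (u + m * s) ≤ m := by
    intro m
    induction m with
    | zero => intro u; simp
    | succ m ih =>
      intro u
      refine (SimpleGraph.edist_triangle (v := u + m * s)).trans ?_
      have := hs (u + m * s)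
      rw [show u + m * s + s = u + ((m + 1 : ℕ) : ZMod n) * s by push_cast; ring] at this
      push_cast at this ⊢
      exact add_le_add (ih u) this
  rcases Int.eq_nat_or_neg x with ⟨m, rfl | rfl⟩
  · simpa using hnat m u
  · have := hnat m (u + ((-m : ℤ) : ZMod n) * s)
    rw [SimpleGraph.edist_comm] at this
    push_cast at this ⊢
    simpa using this

theorem edist_add_le {n : ℕ} (u : ZMod n) (x y : ℤ) :
    (circulantOneA n a).edist u (u + x + y * a) ≤ ((x.natAbs + y.natAbs : ℕ) : ℕ∞) := by
  have hs : ∀ s : ZMod n, (s = 1 ∨ s = a) → ∀ u, (circulantOneA n a).edist u (u + s) ≤ 1 := by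
    intro s hs u
    rw [SimpleGraph.edist_le_one_iff_adj_or_eq]
    by_cases h : u = u + s
    · exact .inr h
    · refine .inl (adj_iff.2 ⟨h, ?_⟩)
      rcases hs with rfl | rfl <;> tauto
  refine (SimpleGraph.edist_triangle (v := u + x)).trans ?_
  push_cast
  refine add_le_add ?_ (edist_add_zsmul_le _ (hs _ (.inr rfl)) _ _)
  simpa using edist_add_zsmul_le _ (hs 1 (.inl rfl)) u x

theorem edist_le [NeZero (q * a)] (ha : 1 ≤ a) (u v : ZMod (q * a)) :
    (circulantOneA (q * a) a).edist u v ≤ ((a / 2 + q / 2 : ℕ) : ℕ∞) := by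
  have hred : ∀ (x : ℤ) (y : ℕ), x.natAbs ≤ a / 2 → y ≤ q → v = u + x + (y : ℤ) * (a : ZMod (q * a)) →
      (circulantOneA (q * a) a).edist u v ≤ ((a / 2 + q / 2 : ℕ) : ℕ∞) := by
    intro x y hx hy hv
    rcases Nat.lt_or_ge (q / 2) y with h | h
    · have hqa : (q : ZMod (q * a)) * a = 0 := by exact_mod_cast ZMod.natCast_self (q * a)
      have hv' : v = u + x + ((y - q : ℤ) : ZMod (q * a)) * a := by
        rw [hv]; push_cast; linear_combination hqa
      rw [hv']
      refine (edist_add_le _ _ _).trans (Nat.cast_le.2 (by omega))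
    · rw [hv]
      refine (edist_add_le u x y).trans (Nat.cast_le.2 (by omega))
  set m := (v - u).val
  have hm : m < q * a := ZMod.val_lt _
  have hv : v = u + (m : ZMod (q * a)) := by rw [ZMod.natCast_zmod_val]; abel
  have hc := Nat.mod_lt m ha
  have hr : m / a < q := Nat.div_lt_of_lt_mul (by rwa [mul_comm])
  have hdm : (a : ZMod (q * a)) * (m / a : ℕ) + (m % a : ℕ) = m := by
    exact_mod_cast congrArg (Nat.cast : ℕ → ZMod (q * a)) (Nat.div_add_mod m a)
  -- A remainder beyond `a / 2` is reached backwards from the next row, which may be row `q`, that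
  -- is, row 0.
  rcases Nat.lt_or_ge (a / 2) (m % a) with h | h
  · refine hred ((m % a : ℕ) - a : ℤ) (m / a + 1) (by omega) (by omega) ?_
    rw [hv, ← hdm]
    simp only [Int.cast_sub, Int.cast_natCast, Nat.cast_add, Nat.cast_one, Int.cast_add, Int.cast_one]
    ring
  · refine hred (m % a : ℕ) (m / a) (by omega) (by omega) ?_
    rw [hv, ← hdm]
    simp only [Int.cast_natCast]
    ring

theorem connected [NeZero (q * a)] (ha : 1 ≤ a) : (circulantOneA (q * a) a).Connected := by
  refine { preconnected := fun u v => SimpleGraph.reachable_of_edist_ne_top ?_ }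
  exact ne_top_of_le_ne_top (ENat.natCast_ne_top _) (edist_le ha u v)

theorem dist_add_le {n : ℕ} (u : ZMod n) (x y : ℤ) :
    (circulantOneA n a).dist u (u + x + y * a) ≤ x.natAbs + y.natAbs :=
  ENat.toNat_le_of_le_natCast (edist_add_le u x y)

/-! ### Independent sets in small balls -/

theorem eq_zero_of_dvd {m : ℕ} {x : ℤ} (h : (m : ℤ) ∣ x) (hx : x.natAbs < m) : x = 0 :=
  Int.eq_zero_of_abs_lt_dvd h (by rw [Int.abs_eq_natAbs]; exact_mod_cast hx)

/-- The first `2 * k + 1` points run along a zigzag in two rows; the last one lies in a third row. -/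
def zigzag (k : ℕ) (j : ℕ) : ℤ × ℤ :=
  if j = 2 * k + 1 then (1 - k, -1) else (j - k, (j % 2 : ℕ))

/-- All points lie in one colour class of the checkerboard, so in the plane grid no two are
adjacent. -/
theorem zigzag_spec {k j : ℕ} (hk : 1 ≤ k) (hj : j < 2 * k + 2) :
    (zigzag k j).1.natAbs + (zigzag k j).2.natAbs ≤ k ∧ (zigzag k j).2.natAbs ≤ 1 ∧
      ((zigzag k j).1 + (zigzag k j).2 - k) % 2 = 0 := by
  unfold zigzag
  split_ifs with h <;> dsimp only <;> omega

theorem zigzag_injective (k : ℕ) : Function.Injective (zigzag k) := by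
  intro i j h
  unfold zigzag at h
  split_ifs at h with h1 h2 h2 <;> simp only [Prod.mk.injEq] at h <;> omega

-- The map `g` wraps the grid onto the graph. By additivity, only differences of zigzag points
-- matter: the hypotheses exclude that wrapping identifies two of them or makes them adjacent.
-- Leaving `g` abstract lets the zigzag run along either generator.
open Finset in
theorem exists_indepSet_of_separated {n : ℕ} {k : ℕ} (hk : 1 ≤ k)
    (g : ℤ → ℤ → ZMod n)
    (hdist : ∀ u x y, (circulantOneA n a).dist u (u + g x y) ≤ x.natAbs + y.natAbs)
    (hg : ∀ x y x' y', g x y - g x' y' = g (x - x') (y - y'))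
    (h0 : ∀ x y, x.natAbs ≤ 2 * k → y.natAbs ≤ 2 → (x + y) % 2 = 0 → g x y = 0 → x = 0 ∧ y = 0)
    (h1 : ∀ x y, x.natAbs ≤ 2 * k → y.natAbs ≤ 2 → (x + y) % 2 = 0 → g x y ≠ 1 ∧ g x y ≠ a)
    (u : ZMod n) :
    ∃ T : Finset (ZMod n), (circulantOneA n a).IsIndepSet T ∧ #T = 2 * k + 2 ∧
      ∀ t ∈ T, (circulantOneA n a).dist u t ≤ k := by
  classical
  set p : ℕ → ZMod n := fun j => u + g (zigzag k j).1 (zigzag k j).2 with hp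
  have hsub : ∀ i j, p i - p j =
      g ((zigzag k i).1 - (zigzag k j).1) ((zigzag k i).2 - (zigzag k j).2) := by
    intro i j
    rw [← hg]; simp only [hp]; abel
  refine ⟨(range (2 * k + 2)).image p, ?_, ?_, ?_⟩
  · apply isIndepSet_of_forall
    intro x hx
    simp only [coe_image, coe_range, Set.mem_image, Set.mem_Iio] at hx ⊢
    obtain ⟨i, hi, rfl⟩ := hx
    have si := zigzag_spec hk hi
    constructor
    · rintro ⟨j, hj, hij⟩
      have sj := zigzag_spec hk hj
      refine (h1 _ _ ?_ ?_ ?_).1 ((hsub j i).symm.trans (by rw [hij]; abel)) <;> omega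
    · rintro ⟨j, hj, hij⟩
      have sj := zigzag_spec hk hj
      refine (h1 _ _ ?_ ?_ ?_).2 ((hsub j i).symm.trans (by rw [hij]; abel)) <;> omega
  · rw [card_image_of_injOn, card_range]
    intro i hi j hj hij
    simp only [coe_range, Set.mem_Iio] at hi hj
    have si := zigzag_spec hk hi
    have sj := zigzag_spec hk hj
    obtain ⟨e1, e2⟩ := h0 _ _ (by omega) (by omega) (by omega)
      ((hsub i j).symm.trans (by rw [hij]; abel))
    exact zigzag_injective k (Prod.ext (by omega) (by omega))
  · intro t ht
    simp only [mem_image, mem_range] at ht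
    obtain ⟨j, hj, rfl⟩ := ht
    exact (hdist _ _ _).trans (zigzag_spec hk hj).1

theorem exists_indepSet_row [NeZero (q * a)] {k : ℕ} (ha : 5 ≤ a) (hq : 4 ≤ q) (hk : 1 ≤ k)
    (hka : 2 * k + 1 ≤ a) (u : ZMod (q * a)) :
    ∃ T : Finset (ZMod (q * a)), (circulantOneA (q * a) a).IsIndepSet T ∧ T.card = 2 * k + 2 ∧
      ∀ t ∈ T, (circulantOneA (q * a) a).dist u t ≤ k := by
  have hdvd : ∀ x y : ℤ, ((x + y * a : ℤ) : ZMod (q * a)) = 0 →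
      (a : ℤ) ∣ x ∧ (x = 0 → (q : ℤ) ∣ y) := by
    intro x y h
    rw [ZMod.intCast_zmod_eq_zero_iff_dvd] at h
    push_cast at h
    refine ⟨(Int.dvd_add_left (dvd_mul_left _ _)).1 ((dvd_mul_left _ _).trans h), ?_⟩
    rintro rfl
    rw [zero_add] at h
    exact Int.dvd_of_mul_dvd_mul_right (by omega) h
  refine exists_indepSet_of_separated hk (fun x y => ((x + y * a : ℤ) : ZMod (q * a))) ?_ ?_ ?_ ?_ u
  · intro u x y
    simpa [add_assoc] using dist_add_le (a := a) u x y
  · intros; push_cast; ring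
  · intro x y hx hy hxy h
    obtain ⟨h1, h2⟩ := hdvd _ _ h
    have hx0 := eq_zero_of_dvd h1 (by omega)
    exact ⟨hx0, eq_zero_of_dvd (h2 hx0) (by omega)⟩
  · intro x y hx hy hxy
    constructor
    · intro h
      obtain ⟨⟨c, hc⟩, h2⟩ := hdvd (x - 1) y (by push_cast at h ⊢; linear_combination h)
      have hc0 : c = 0 ∨ c = -1 := by
        have hxl : -(a : ℤ) < x := by omega
        have hxu : x < a := by omega
        have : -2 < c := by nlinarith
        have : c < 1 := by nlinarith
        omega
      rcases hc0 with rfl | rfl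
      · have := eq_zero_of_dvd (h2 (by omega)) (by omega)
        omega
      -- Here `x = 1 - a`, which the bound on `x` permits only if `a = 2 * k + 1`; then `y = 1` and
      -- `x + y = 2 - a` is odd.
      · obtain ⟨-, h3⟩ := hdvd 0 (y - 1) (by
          have hx : x = 1 - a := by omega
          rw [hx] at h
          push_cast at h ⊢; linear_combination h)
        have := eq_zero_of_dvd (h3 rfl) (by omega)
        omega
    · intro h
      obtain ⟨h1, h2⟩ := hdvd x (y - 1) (by push_cast at h ⊢; linear_combination h)
      have hx0 := eq_zero_of_dvd h1 (by omega)
      have := eq_zero_of_dvd (h2 hx0) (by omega)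
      omega

theorem exists_indepSet_column [NeZero (q * a)] {k : ℕ} (ha : 5 ≤ a) (hk : 1 ≤ k)
    (hkq : 2 * k + 2 ≤ q) (u : ZMod (q * a)) :
    ∃ T : Finset (ZMod (q * a)), (circulantOneA (q * a) a).IsIndepSet T ∧ T.card = 2 * k + 2 ∧
      ∀ t ∈ T, (circulantOneA (q * a) a).dist u t ≤ k := by
  have hdvd : ∀ x y : ℤ, ((y + x * a : ℤ) : ZMod (q * a)) = 0 → y.natAbs < a →
      y = 0 ∧ (q : ℤ) ∣ x := by
    intro x y h hy
    rw [ZMod.intCast_zmod_eq_zero_iff_dvd] at h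
    push_cast at h
    obtain rfl := eq_zero_of_dvd
      ((Int.dvd_add_left (dvd_mul_left _ _)).1 ((dvd_mul_left _ _).trans h)) hy
    rw [zero_add] at h
    exact ⟨rfl, Int.dvd_of_mul_dvd_mul_right (by omega) h⟩
  refine exists_indepSet_of_separated hk (fun x y => ((y + x * a : ℤ) : ZMod (q * a))) ?_ ?_ ?_ ?_ u
  · intro u x y
    have := dist_add_le (a := a) u y x
    rw [add_comm x.natAbs]
    simpa [add_assoc] using this
  · intros; push_cast; ring
  · intro x y hx hy hxy h
    obtain ⟨h1, h2⟩ := hdvd _ _ h (by omega)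
    exact ⟨eq_zero_of_dvd h2 (by omega), h1⟩
  · intro x y hx hy hxy
    constructor
    · intro h
      obtain ⟨h1, h2⟩ := hdvd x (y - 1) (by push_cast at h ⊢; linear_combination h) (by omega)
      have := eq_zero_of_dvd h2 (by omega)
      omega
    · intro h
      obtain ⟨h1, h2⟩ := hdvd (x - 1) y (by push_cast at h ⊢; linear_combination h) (by omega)
      have := eq_zero_of_dvd h2 (by omega)
      omega

theorem exists_indepSet_near [NeZero (q * a)] (ha : 5 ≤ a) (hq : 4 ≤ q) {m : ℕ} (hm : 1 ≤ m)
    (hm2 : m ≠ 2) (hmd : m ≤ a / 2 + q / 2) (u : ZMod (q * a)) :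
    ∃ T : Finset (ZMod (q * a)), (circulantOneA (q * a) a).IsIndepSet T ∧ T.card = m ∧
      ∀ t ∈ T, 2 * (circulantOneA (q * a) a).dist u t + 1 ≤ m := by
  rcases Nat.lt_or_ge m 3 with h | h
  · obtain rfl : m = 1 := by omega
    exact ⟨{u}, by simp [SimpleGraph.IsIndepSet], by simp, by simp⟩
  · obtain ⟨T, hT, hTc, hTd⟩ : ∃ T : Finset (ZMod (q * a)),
        (circulantOneA (q * a) a).IsIndepSet T ∧ T.card = 2 * ((m - 1) / 2) + 2 ∧
        ∀ t ∈ T, (circulantOneA (q * a) a).dist u t ≤ (m - 1) / 2 := by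
      -- If the zigzag is too long for a row, then `m ≤ a / 2 + q / 2` forces `q` to be large enough
      -- for a column.
      rcases Nat.lt_or_ge a (2 * ((m - 1) / 2) + 1) with h' | h'
      · exact exists_indepSet_column ha (by omega) (by omega) u
      · exact exists_indepSet_row ha hq (by omega) h' u
    obtain ⟨S, hST, hSc⟩ := Finset.exists_subset_card_eq (show m ≤ T.card by omega)
    refine ⟨S, hT.mono (by exact_mod_cast hST), hSc, fun t ht => ?_⟩
    have := hTd t (hST ht)
    omega

/-! ### From independent broadcasts to independent sets -/

/-- The closed neighbourhood of `u`. -/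
def closedNbhd (n a : ℕ) (u : ZMod n) : Finset (ZMod n) :=
  ({0, 1, -1, (a : ZMod n), -(a : ZMod n)} : Finset (ZMod n)).map (addLeftEmbedding u)

theorem card_closedNbhd (ha : 5 ≤ a) (hq : 4 ≤ q) (u : ZMod (q * a)) :
    (closedNbhd (q * a) a u).card = 5 := by
  have hlt : 4 * a ≤ q * a := Nat.mul_le_mul_right _ hq
  have h1 := natCast_ne_zero_of_lt (n := q * a) (m := 1) (by omega) (by omega)
  have h2 := natCast_ne_zero_of_lt (n := q * a) (m := 2) (by omega) (by omega)
  have h3 := natCast_ne_zero_of_lt (n := q * a) (m := a) (by omega) (by omega)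
  have h4 := natCast_ne_zero_of_lt (n := q * a) (m := 2 * a) (by omega) (by omega)
  have h5 := natCast_ne_zero_of_lt (n := q * a) (m := a + 1) (by omega) (by omega)
  have h6 := natCast_ne_zero_of_lt (n := q * a) (m := a - 1) (by omega) (by omega)
  rw [Nat.cast_sub (by omega)] at h6
  push_cast at h1 h2 h3 h4 h5 h6
  rw [closedNbhd, Finset.card_map, Finset.card_insert_of_notMem, Finset.card_insert_of_notMem,
    Finset.card_insert_of_notMem, Finset.card_insert_of_notMem, Finset.card_singleton]
  all_goals simp only [Finset.mem_insert, Finset.mem_singleton, not_or]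
  · exact fun h => h4 (by linear_combination h)
  · exact ⟨fun h => h5 (by linear_combination -h), fun h => h6 (by linear_combination h)⟩
  · exact ⟨fun h => h2 (by linear_combination h), fun h => h6 (by linear_combination -h),
      fun h => h5 (by linear_combination h)⟩
  · exact ⟨fun h => h1 (by linear_combination -h), fun h => h1 (by linear_combination h),
      fun h => h3 (by linear_combination -h), fun h => h3 (by linear_combination h)⟩

theorem dist_le_of_mem_closedNbhd {n : ℕ} {u v : ZMod n} (h : v ∈ closedNbhd n a u) :
    (circulantOneA n a).dist u v ≤ 1 := by
  simp only [closedNbhd, Finset.mem_map, Finset.mem_insert, Finset.mem_singleton,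
    addLeftEmbedding_apply] at h
  obtain ⟨d, rfl | rfl | rfl | rfl | rfl, rfl⟩ := h
  · simp
  · simpa using dist_add_le (a := a) u 1 0
  · simpa using dist_add_le (a := a) u (-1) 0
  · simpa using dist_add_le (a := a) u 0 1
  · simpa using dist_add_le (a := a) u 0 (-1)

theorem dist_le_one_of_adj_or_eq {V : Type*} {G : SimpleGraph V} {u v : V}
    (h : G.Adj u v ∨ u = v) : G.dist u v ≤ 1 := by
  rcases h with h | rfl
  · exact (SimpleGraph.dist_eq_one_iff_adj.2 h).le
  · simp

theorem broadcastCost_eq_sum {V : Type*} [Fintype V] (f : V → ℕ) :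
    broadcastCost f = ∑ v, f v := by
  refine Finset.sum_subset (Finset.subset_univ _) fun v _ hv => ?_
  simpa [broadcastVertices] using hv

open Finset in
theorem broadcastCost_le_indepNum [NeZero (q * a)] (ha : 5 ≤ a) (hq : 4 ≤ q)
    (hα : 2 * (q * a) ≤ 5 * (circulantOneA (q * a) a).indepNum) {f : ZMod (q * a) → ℕ}
    (hf : IsIndepBroadcast (circulantOneA (q * a) a) f) :
    broadcastCost f ≤ (circulantOneA (q * a) a).indepNum := by
  classical
  set G := circulantOneA (q * a) a with hG
  have hconn : G.Connected := connected (by omega)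
  have hle : ∀ u, f u ≤ a / 2 + q / 2 := fun u => by
    exact_mod_cast (hf.le_eccent u).trans ((SimpleGraph.eccent_le_iff _ _).2 (edist_le (by omega) u))
  have hsep : ∀ u v, 0 < f u → 0 < f v → u ≠ v → max (f u) (f v) < G.dist u v := fun u v hu hv =>
    hf.indep u (by simpa [broadcastVertices] using hu) v (by simpa [broadcastVertices] using hv)
  have hexists : ∀ u, ∃ T : Finset (ZMod (q * a)), G.IsIndepSet T ∧
      #T = (if f u = 2 then 0 else f u) ∧ ∀ t ∈ T, f u ≠ 2 ∧ 2 * G.dist u t + 1 ≤ f u := by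
    intro u
    by_cases h0 : f u = 0
    · exact ⟨∅, by simp [SimpleGraph.IsIndepSet], by simp [h0], by simp⟩
    by_cases h2 : f u = 2
    · exact ⟨∅, by simp [SimpleGraph.IsIndepSet], by simp [h2], by simp⟩
    obtain ⟨T, hT, hTc, hTd⟩ := exists_indepSet_near ha hq (by omega) h2 (hle u) u
    exact ⟨T, hT, by simp [h2, hTc], fun t ht => ⟨h2, hTd t ht⟩⟩
  choose T hT hTc hTd using hexists
  have htri : ∀ u v x y, G.dist x y ≤ 1 → G.dist u v ≤ G.dist u x + G.dist v y + 1 := by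
    intro u v x y hxy
    have h1 := hconn.dist_triangle (u := u) (v := x) (w := v)
    have h2 := hconn.dist_triangle (u := x) (v := y) (w := v)
    rw [G.dist_comm (u := y)] at h2
    omega
  -- Otherwise `d(u, v)` would be at most the mean of `f u` and `f v`, hence at most their maximum.
  have hTT : ∀ u v x y, x ∈ T u → y ∈ T v → G.dist x y ≤ 1 → u = v := by
    intro u v x y hx hy hxy
    by_contra huv
    have hx' := hTd u x hx
    have hy' := hTd v y hy
    have h1 := hsep u v (by omega) (by omega) huv
    have h2 := htri u v x y hxy
    omega
  have hTB : ∀ u v x y, x ∈ T u → f v = 2 → y ∈ closedNbhd (q * a) a v → 1 < G.dist x y := by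
    intro u v x y hx hv hy
    by_contra! hxy
    have hx' := hTd u x hx
    have hy' : G.dist v y ≤ 1 := dist_le_of_mem_closedNbhd hy
    have h1 := hsep u v (by omega) (by omega) (by rintro rfl; exact hx'.1 hv)
    have h2 := htri u v x y hxy
    omega
  set D : Finset (ZMod (q * a)) := {u | f u = 2} with hD
  set B := D.biUnion (closedNbhd (q * a) a) with hB
  have hBc : #B = #D * 5 := by
    rw [hB, card_biUnion, sum_const_nat fun u _ => card_closedNbhd ha hq u]
    intro u hu v hv huv
    rw [Function.onFun, disjoint_left]
    intro x hx hx'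
    simp only [hD, coe_filter, mem_univ, true_and, Set.mem_ofPred_eq] at hu hv
    have h1 := hsep u v (by omega) (by omega) huv
    have h2 : G.dist u x ≤ 1 := dist_le_of_mem_closedNbhd hx
    have h3 : G.dist v x ≤ 1 := dist_le_of_mem_closedNbhd hx'
    have h4 := hconn.dist_triangle (u := u) (v := x) (w := v)
    rw [G.dist_comm (u := x)] at h4
    omega
  obtain ⟨I, hI⟩ := G.exists_isNIndepSet_indepNum
  obtain ⟨s, hs⟩ := exists_translate_card id I B
  rw [hI.card_eq, ZMod.card, hBc] at hs
  set J : Finset (ZMod (q * a)) := {w ∈ B | w + s ∈ I} with hJ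
  have hJc : 2 * #D ≤ #J := by
    refine Nat.le_of_mul_le_mul_left (le_trans ?_ hs) (NeZero.pos (q * a))
    nlinarith [Nat.mul_le_mul_left #D hα]
  set P := univ.biUnion T with hP
  have hPc : #P = ∑ u, if f u = 2 then 0 else f u := by
    rw [hP, card_biUnion]
    · exact sum_congr rfl fun u _ => hTc u
    · intro u _ v _ huv
      rw [Function.onFun, disjoint_left]
      exact fun x hx hx' => huv (hTT u v x x hx hx' (by simp))
  have hPJ : ∀ x ∈ P, ∀ y ∈ J, 1 < G.dist x y := by
    intro x hx y hy
    simp only [hP, hJ, hB, hD, mem_biUnion, mem_filter, mem_univ, true_and] at hx hy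
    obtain ⟨u, hu⟩ := hx
    obtain ⟨⟨v, hv, hv'⟩, -⟩ := hy
    exact hTB u v x y hu hv hv'
  have hdisj : Disjoint P J := disjoint_left.2 fun x hx hx' => by simpa using hPJ x hx x hx'
  -- Neighbourhoods of two value-2 vertices may be joined by edges; independence comes from the
  -- single common translate.
  have hJI : G.IsIndepSet J := (isIndepSet_translate hI.isIndepSet s).mono
    fun x hx => (mem_filter.1 (mem_coe.1 hx)).2
  have hPI : G.IsIndepSet P := by
    intro x hx y hy hxy hadj
    simp only [hP, coe_biUnion, Set.mem_iUnion, mem_coe] at hx hy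
    obtain ⟨u, -, hu⟩ := hx
    obtain ⟨v, -, hv⟩ := hy
    obtain rfl := hTT u v x y hu hv (dist_le_one_of_adj_or_eq (.inl hadj))
    exact hT u hu hv hxy hadj
  have hindep : G.IsIndepSet (disjUnion P J hdisj : Finset (ZMod (q * a))) := by
    rw [coe_disjUnion]
    intro x hx y hy hxy hadj
    have hd := dist_le_one_of_adj_or_eq (.inl hadj)
    rcases hx with hx | hx <;> rcases hy with hy | hy
    · exact hPI hx hy hxy hadj
    · exact absurd (hPJ x hx y hy) (by omega)
    · exact absurd (hPJ y hy x hx) (by rw [G.dist_comm]; omega)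
    · exact hJI hx hy hxy hadj
  have hcard := hindep.card_le_indepNum
  rw [card_disjUnion] at hcard
  have hcost : broadcastCost f = #P + 2 * #D := by
    rw [broadcastCost_eq_sum, hPc, hD, card_filter, mul_sum, ← sum_add_distrib]
    refine sum_congr rfl fun u _ => ?_
    split_ifs <;> omega
  omega

open Finset in
theorem indepNum_le_broadcastIndepNum {V : Type*} [Fintype V] [Nontrivial V] {G : SimpleGraph V}
    (hG : G.Connected) : G.indepNum ≤ broadcastIndepNum G := by
  classical
  obtain ⟨I, hI⟩ := G.exists_isNIndepSet_indepNum
  have htop := SimpleGraph.connected_iff_ediam_ne_top.1 hG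
  refine (isGreatest_broadcastIndepNum G).2 ⟨fun v => if v ∈ I then 1 else 0, ⟨⟨?_, ?_⟩, ?_⟩, ?_⟩
  · intro v
    have := SimpleGraph.diam_ne_zero_of_ediam_ne_top htop
    split_ifs <;> omega
  · intro v
    have := SimpleGraph.eccent_ne_zero (G := G) v
    split_ifs
    · simpa using Order.one_le_iff_ne_zero.2 this
    · simp
  · intro u hu v hv huv
    simp only [broadcastVertices, mem_filter, mem_univ, true_and] at hu hv
    have hu' : u ∈ I := by by_contra h; simp [h] at hu
    have hv' : v ∈ I := by by_contra h; simp [h] at hv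
    simpa [hu', hv'] using hG.one_lt_dist_of_ne_of_not_adj huv (hI.isIndepSet hu' hv' huv)
  · rw [broadcastCost_eq_sum, ← hI.card_eq]
    simp

theorem broadcastIndepNum_eq_indepNum [NeZero (q * a)] (ha : 5 ≤ a) (hq : 4 ≤ q)
    (hα : 2 * (q * a) ≤ 5 * (circulantOneA (q * a) a).indepNum) :
    broadcastIndepNum (circulantOneA (q * a) a) = (circulantOneA (q * a) a).indepNum := by
  have : Fact (1 < q * a) := ⟨by nlinarith⟩
  refine le_antisymm ?_ (indepNum_le_broadcastIndepNum (connected (by omega)))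
  obtain ⟨f, hf, hc⟩ := (isGreatest_broadcastIndepNum (circulantOneA (q * a) a)).1
  exact hc ▸ broadcastCost_le_indepNum ha hq hα hf

/-! ### Exact values of the independence number -/

theorem floor_eq (q a : ℕ) :
    ⌊(q : ℚ) * (a : ℚ) ^ 2 / (2 * ((a : ℚ) + 1))⌋ = ((q * a * a / (2 * (a + 1)) : ℕ) : ℤ) := by
  rw [show (q : ℚ) * (a : ℚ) ^ 2 / (2 * ((a : ℚ) + 1)) =
    ((q * a * a : ℕ) : ℚ) / ((2 * (a + 1) : ℕ) : ℚ) by push_cast; ring]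
  rw [Rat.floor_natCast_div_natCast, Int.natCast_ediv]

theorem indepNum_le_floor [NeZero (q * a)] (ha : 5 ≤ a) (hq : 4 ≤ q) (hae : Even a) :
    (circulantOneA (q * a) a).indepNum ≤ q * a * a / (2 * (a + 1)) := by
  have := indepNum_le_window (q := q) (by omega) (by omega) hae
  rw [Nat.le_div_iff_mul_le (by omega)]
  linarith

theorem indepNum_of_odd [NeZero (q * a)] (hq : 4 ≤ q) (hao : Odd a) :
    (circulantOneA (q * a) a).indepNum = a * (q / 2) :=
  le_antisymm (indepNum_le_column hao.pos (by omega)) (le_indepNum_of_odd (by omega) hao)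

theorem indepNum_of_even_of_lt [NeZero (q * a)] (hq : 4 ≤ q) (hae : Even a) (hqo : Odd q)
    (hlt : q < a) : (circulantOneA (q * a) a).indepNum = a * (q / 2) :=
  le_antisymm (indepNum_le_column (by omega) (by omega))
    (le_indepNum_of_even_of_lt (by omega) hae hqo hlt)

theorem indepNum_of_even [NeZero (q * a)] (ha : 5 ≤ a) (hq : 4 ≤ q) (hae : Even a)
    (h : Even q ∨ a < q) :
    (circulantOneA (q * a) a).indepNum = q * a * a / (2 * (a + 1)) ∧
      2 * (q * a) ≤ 5 * (circulantOneA (q * a) a).indepNum := by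
  set F := q * a * a / (2 * (a + 1)) with hF
  have hF1 : F * (2 * (a + 1)) ≤ q * a * a := Nat.div_mul_le_self _ _
  have hlt : 2 * F ≤ q * a := by nlinarith
  obtain ⟨t, ht⟩ : ∃ t, 2 * F + t = q * a := ⟨q * a - 2 * F, by omega⟩
  have h2 : t * a ≤ q * a + t := by
    -- With `s = q / 2`, the last inequality gives `q * a / 2 - s ≤ F`, hence `t ≤ 2 * s ≤ q`. For
    -- odd `q` it amounts to `a < q`.
    obtain ⟨s, hs, hsq, hsa⟩ : ∃ s, 2 * s ≤ q + 1 ∧ 2 * s ≤ q ∧ q * a ≤ 2 * s * (a + 1) := by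
      rcases Nat.even_or_odd q with ⟨s, rfl⟩ | ⟨s, rfl⟩
      · exact ⟨s, by omega, by omega, by nlinarith⟩
      · rcases h with h | h
        · exact absurd h (by simp)
        · exact ⟨s, by omega, by omega, by nlinarith⟩
    obtain ⟨b, rfl⟩ := hae
    have hsb : s ≤ q * b := by nlinarith
    have hFs : q * b - s ≤ F := by
      rw [hF, Nat.le_div_iff_mul_le (by omega)]
      zify [hsb]
      zify at hsa
      nlinarith
    have htq : t ≤ q := by
      have : q * (b + b) = 2 * (q * b) := by ring
      omega
    nlinarith
  have h1 : q * a ≤ t * (a + 1) := by nlinarith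
  have h6 : 6 ≤ a := by
    obtain ⟨b, rfl⟩ := hae
    omega
  have ht5 : 5 * t ≤ q * a := by nlinarith
  have hle := le_indepNum_of_even (q := q) (by omega) hae (p := F) (by nlinarith) ht h1 h2
  exact ⟨le_antisymm (indepNum_le_floor ha hq hae) hle, by omega⟩

theorem five_mul_indepNum_ge [NeZero (q * a)] (ha : 5 ≤ a) (hq : 4 ≤ q) :
    2 * (q * a) ≤ 5 * (circulantOneA (q * a) a).indepNum := by
  have hcol : 2 * (q * a) ≤ 5 * (a * (q / 2)) := by
    -- Equality holds at `q = 5`.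
    have : 2 * q ≤ 5 * (q / 2) := by omega
    nlinarith
  rcases Nat.even_or_odd a with hae | hao
  · by_cases h : Even q ∨ a < q
    · exact (indepNum_of_even ha hq hae h).2
    · push Not at h
      obtain ⟨hqo, hqa⟩ := h
      rw [Nat.not_even_iff_odd] at hqo
      have : q ≠ a := by rintro rfl; exact (Nat.not_even_iff_odd.2 hqo) hae
      rwa [indepNum_of_even_of_lt hq hae hqo (by omega)]
  · rwa [indepNum_of_odd hq hao]

theorem cast_mul_half_of_odd (hqo : Odd q) :
    ((a * (q / 2) : ℕ) : ℚ) = ((q : ℚ) - 1) * a / 2 := by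
  obtain ⟨r, rfl⟩ := hqo
  rw [show (2 * r + 1) / 2 = r by omega]
  push_cast; ring

end circulantOneA

open circulantOneA in
theorem mainTheorem4 (q a : ℕ) [NeZero (q * a)] (ha : 5 ≤ a) (hq : 4 ≤ q) :
    broadcastIndepNum (circulantOneA (q * a) a) = (circulantOneA (q * a) a).indepNum ∧
    ((circulantOneA (q * a) a).indepNum : ℚ) =
      if Odd a ∧ Even q then (q : ℚ) * a / 2
      else if Odd a ∧ Odd q then ((q : ℚ) - 1) * a / 2
      else if Even a ∧ Even q then (⌊(q : ℚ) * (a : ℚ) ^ 2 / (2 * ((a : ℚ) + 1))⌋ : ℚ)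
      else min (⌊(q : ℚ) * (a : ℚ) ^ 2 / (2 * ((a : ℚ) + 1))⌋ : ℚ) (((q : ℚ) - 1) * a / 2) := by
  refine ⟨broadcastIndepNum_eq_indepNum ha hq (five_mul_indepNum_ge ha hq), ?_⟩
  rw [floor_eq, Int.cast_natCast]
  rcases Nat.even_or_odd a with hae | hao
  · have hao : ¬ Odd a := Nat.not_odd_iff_even.2 hae
    rcases Nat.even_or_odd q with hqe | hqo
    · simp only [hao, hae, hqe, false_and, and_self, if_true, if_false]
      rw [(indepNum_of_even ha hq hae (.inl hqe)).1]
    · have hqe : ¬ Even q := Nat.not_even_iff_odd.2 hqo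
      simp only [hao, hqe, false_and, and_false, if_false]
      rw [← cast_mul_half_of_odd hqo]
      -- Both terms of the minimum are upper bounds; the sign of `q - a` decides which one is
      -- attained.
      rcases Nat.lt_or_ge a q with h | h
      · have hα := (indepNum_of_even ha hq hae (.inr h)).1
        rw [← hα, min_eq_left]
        exact_mod_cast indepNum_le_column (by omega) (by omega)
      · have hne : q ≠ a := by rintro rfl; exact hqe hae
        have hα := indepNum_of_even_of_lt hq hae hqo (by omega)
        rw [← hα, min_eq_right]
        exact_mod_cast indepNum_le_floor ha hq hae
  · rw [indepNum_of_odd hq hao]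
    rcases Nat.even_or_odd q with hqe | hqo
    · simp only [hao, hqe, and_self, if_true]
      obtain ⟨r, rfl⟩ := hqe
      rw [show (r + r) / 2 = r by omega]
      push_cast; ring
    · have hqe : ¬ Even q := Nat.not_even_iff_odd.2 hqo
      simp only [hao, hqo, hqe, and_false, and_self, if_true, if_false]
      exact cast_mul_half_of_odd hqo
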